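/- In the two-oracle model one looks for a basis of an unknown (clean) matroid $\mathcal M$ on a ground set $E$ with $n$ elements. A deterministic algorithm knows a dirty matroid $\mathcal M_d$ on $E$ completely. It adaptively queries the independence oracle of $\mathcal M$ ("is $S$ independent in $\mathcal M$?"; these are the clean queries) until the queries made and their answers form a certificate, i.e. until there is a set $B\subseteq E$ that is a basis of every matroid on $E$ consistent with all recorded answers. For a basis $S$ of $\mathcal M_d$ let $|A(S)|$ be the least size of a set $A\subseteq E\setminus S$ such that $S\cup A$ contains a basis of $\mathcal M$, and $|R(S)|$ the least size of a set $R\subseteq S$ such that $S\setminus R$ is contained in a basis of $\mathcal M$. Let $\eta_A$ and $\eta_R$ be the maxima of $|A(S)|$ and $|R(S)|$ over all bases $S$ of $\mathcal M_d$. Lemma. Let $n, r_d, \eta_A$ be integers with $r_d\ge 0$ and $1\le \eta_A\le n-r_d$. There is a dirty matroid $\mathcal M_d$ of rank $r_d$ on $n$ elements such that for every deterministic algorithm there is, in each of the following two cases, a clean matroid $\mathcal M$ with addition error $\eta_A$ and removal error $\eta_R=0$ on which the algorithm makes at least 1. $n-r+\eta_A$ clean queries, where $r$ is the rank of $\mathcal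 M$, if $\eta_A\le \frac{n-r_d}{2}$; 2. $1+\left\lceil \log_2\binom{n-r_d}{\eta_A}\right\rceil$ clean queries, if $\eta_A\ge\frac{n-r_d}{2}$. This holds even if the algorithm knows $\eta_A$ and $\eta_R=0$ in advance, so that it has to produce a certificate only on clean matroids with these error values; the certificate itself must be valid without this knowledge. -/

import Mathlib

open Set

/-- Given the dirty matroid (which is free to inspect) and any further advance knowledge, a
deterministic algorithm is an adaptive strategy for calling the clean independence oracle: it
either halts, or it queries a set `S` and continues with a strategy chosen by the answer.
Since there are only finitely many matroids on a finite ground set, an algorithm that halts on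
each of its possible inputs unfolds to such a finite tree. -/
inductive CleanAlg (E : Type) : Type
  | halt : CleanAlg E
  | query (S : Set E) (ifIndep ifDep : CleanAlg E) : CleanAlg E

open Classical in
/-- The clean queries, each with its answer, made when the clean matroid is `M`. -/
noncomputable def CleanAlg.transcript {E : Type} (M : Matroid E) : CleanAlg E → List (Set E × Bool)
  | .halt => []
  | .query S ifIndep ifDep =>
      if M.Indep S then (S, true) :: ifIndep.transcript M
      else (S, false) :: ifDep.transcript M

/-- The number of clean queries made when the clean matroid is `M`. -/
noncomputable def CleanAlg.numQueries {E : Type} (T : CleanAlg E) (M : Matroid E) : ℕ :=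
  (T.transcript M).length

/-- A matroid on the ground set `E` that answers all recorded queries as recorded. -/
def ConsistentWith {E : Type} (M : Matroid E) (L : List (Set E × Bool)) : Prop :=
  M.E = univ ∧ ∀ p ∈ L, (M.Indep p.1 ↔ p.2 = true)

/-- The recorded queries and answers are a certificate for a third party without any additional
knowledge: they prove of some set `B` that it is a basis, whatever the matroid behind them is. -/
def IsBasisCertificate {E : Type} (L : List (Set E × Bool)) : Prop :=
  ∃ B : Set E, ∀ M : Matroid E, ConsistentWith M L → M.IsBase B

/-- `|A(S)|`: the least size of a set `A ⊆ E \ S` such that `S ∪ A` contains a basis of `M`. -/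
noncomputable def numAdditions {E : Type} (M : Matroid E) (S : Set E) : ℕ :=
  sInf {k | ∃ A : Set E, A ⊆ M.E \ S ∧ A.ncard = k ∧ ∃ B, M.IsBase B ∧ B ⊆ S ∪ A}

/-- `|R(S)|`: the least size of a set `R ⊆ S` such that `S \ R` lies in a basis of `M`. -/
noncomputable def numRemovals {E : Type} (M : Matroid E) (S : Set E) : ℕ :=
  sInf {k | ∃ R : Set E, R ⊆ S ∧ R.ncard = k ∧ ∃ B, M.IsBase B ∧ S \ R ⊆ B}

/-- The addition error: the maximum of `|A(S)|` over all bases `S` of the dirty matroid. -/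
noncomputable def additionError {E : Type} (Md M : Matroid E) : ℕ :=
  sSup {k | ∃ S, Md.IsBase S ∧ numAdditions M S = k}

/-- The removal error: the maximum of `|R(S)|` over all bases `S` of the dirty matroid. -/
noncomputable def removalError {E : Type} (Md M : Matroid E) : ℕ :=
  sSup {k | ∃ S, Md.IsBase S ∧ numRemovals M S = k}

/-- `M` is a possible clean matroid for the dirty matroid `Md` with the given error values. -/
structure IsCleanInstance {E : Type} (Md M : Matroid E) (ηA ηR : ℕ) : Prop where
  ground_eq : M.E = univ
  additionError_eq : additionError Md M = ηA
  removalError_eq : removalError Md M = ηR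

/-- The strategy `T` solves the basis problem for the dirty matroid `Md` when the values of both
errors are known in advance: only on clean matroids with these errors does it have to be correct.
The certificate it produces has to convince a third party that does not know the errors. -/
def CleanAlg.SolvesKnowing {E : Type} (T : CleanAlg E) (Md : Matroid E) (ηA ηR : ℕ) : Prop :=
  ∀ M : Matroid E, IsCleanInstance Md M ηA ηR → IsBasisCertificate (T.transcript M)

/-! The dirty matroid has a single basis D, and every clean matroid used has a single basis B ⊇ D
with ηA further elements, so nothing need be removed. A certificate must stand against all matroids,
also those with other errors. It therefore contains the accepted query B and, for each e ∉ B, a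
rejected query inside `insert e B` (`IsBasisCertificate.verifies`).

For small ηA, r = rd + ηA turns the goal into n - rd queries, one per element outside D. An
adversary fixes B gradually (`Position.Valid.exists_move`). Rejecting a query with two isolated
elements ties them into a pair, of which B has at most one element; a later query meeting the pair
excludes one element and isolates the other. Each isolated element or pair still owes a query.
Pairing lowers the largest size B can reach; once this equals the required size, sets of isolated
elements must be accepted wholesale, and the pairs left have to pay for the rest. The condition 2ηA
≤ n - rd makes this possible.

For large ηA only the accepted query B matters. A decision tree separates the binom(n - rd, ηA)
candidates, and querying a candidate isolates that one alone, which forces one query beyond the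
logarithm (`exists_two_mul_card_le_two_pow`). -/

/-! ### Matroids with a single basis and their errors -/

section UniqueBase

variable {E : Type}

/-- The matroid on all of `E` whose only basis is `B`. -/
noncomputable def soleBase (B : Finset E) : Matroid E := Matroid.uniqueBaseOn (B : Set E) univ

theorem soleBase_indep (B : Finset E) (S : Set E) : (soleBase B).Indep S ↔ S ⊆ B :=
  Matroid.uniqueBaseOn_indep_iff (subset_univ _)

theorem soleBase_isBase (B : Finset E) (S : Set E) : (soleBase B).IsBase S ↔ S = B :=
  Matroid.uniqueBaseOn_isBase_iff (subset_univ _)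

theorem soleBase_eRank (B : Finset E) : (soleBase B).eRank = (B.card : ℕ∞) := by
  rw [← ((soleBase_isBase B _).2 rfl).encard_eq_eRank, Set.encard_coe_eq_coe_finsetCard]

theorem numAdditions_soleBase [Finite E] [DecidableEq E] {D B : Finset E} :
    numAdditions (soleBase B) (D : Set E) = (B \ D).card := by
  have key : ∀ A : Set E,
      (∃ B', (soleBase B).IsBase B' ∧ B' ⊆ (D : Set E) ∪ A) → ((B \ D : Finset E) : Set E) ⊆ A := by
    rintro A ⟨B', hB', hsub⟩ x hx
    rw [soleBase_isBase] at hB'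
    subst hB'
    simp only [Finset.coe_sdiff, mem_sdiff] at hx
    exact (hsub hx.1).resolve_left hx.2
  unfold numAdditions
  refine IsLeast.csInf_eq ⟨⟨((B \ D : Finset E) : Set E), ?_, ?_, B, ?_, ?_⟩, ?_⟩
  · intro x hx
    simp only [Finset.coe_sdiff, mem_sdiff] at hx
    exact ⟨mem_univ x, hx.2⟩
  · exact Set.ncard_coe_finset _
  · rw [soleBase_isBase]
  · intro x hx
    by_cases hD : x ∈ D
    · exact Or.inl hD
    · exact Or.inr (by simpa using ⟨by simpa using hx, hD⟩)
  · rintro k ⟨A, -, rfl, hB⟩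
    rw [← Set.ncard_coe_finset]
    exact Set.ncard_le_ncard (key A hB) A.toFinite

theorem numRemovals_soleBase {D B : Finset E} (h : D ⊆ B) :
    numRemovals (soleBase B) (D : Set E) = 0 := by
  refine Nat.sInf_eq_zero.2 (Or.inl ⟨∅, empty_subset _, Set.ncard_empty _, B, ?_, ?_⟩)
  · rw [soleBase_isBase]
  · simpa using h

theorem isCleanInstance_soleBase [Finite E] [DecidableEq E] {D B : Finset E} (h : D ⊆ B) :
    IsCleanInstance (soleBase D) (soleBase B) (B.card - D.card) 0 where
  ground_eq := rfl
  additionError_eq := by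
    simp [additionError, soleBase_isBase, numAdditions_soleBase, Finset.card_sdiff_of_subset h]
  removalError_eq := by
    simp [removalError, soleBase_isBase, numRemovals_soleBase h]

/-- The matroid on all of `E` whose independent sets are the proper subsets of `B`. -/
noncomputable def properSubsets [Finite E] (B : Finset E) (hB : B.Nonempty) : Matroid E :=
  (IndepMatroid.ofFinite (E := univ) Set.finite_univ (fun I : Set E => I ⊂ (B : Set E))
    (Set.empty_ssubset.2 (by simpa using hB))
    (fun _ _ hJ hIJ => hIJ.trans_ssubset hJ)
    (by
      intro I J hI hJ hlt
      obtain ⟨e, heJ, heI⟩ := Set.exists_mem_notMem_of_ncard_lt_ncard hlt I.toFinite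
      refine ⟨e, heJ, heI, (Set.insert_subset (hJ.subset heJ) hI.subset).ssubset_of_ne ?_⟩
      intro heq
      have h1 := Set.ncard_lt_ncard hJ (Set.toFinite _)
      rw [← heq, Set.ncard_insert_of_notMem heI I.toFinite] at h1
      omega)
    (fun _ _ => subset_univ _)).matroid

theorem properSubsets_indep [Finite E] (B : Finset E) (hB : B.Nonempty) (S : Set E) :
    (properSubsets B hB).Indep S ↔ S ⊂ (B : Set E) := by
  simp [properSubsets]

end UniqueBase

/-! ### What every certificate must contain -/

section Certificates

variable {E : Type}

/-- The recorded queries show `B` to be independent and each set `insert e B` to be dependent. -/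
def Verifies (B : Finset E) (L : List (Set E × Bool)) : Prop :=
  ((B : Set E), true) ∈ L ∧
    ∀ e ∉ B, ∃ Q : Set E, (Q, false) ∈ L ∧ Q ⊆ insert e (B : Set E)

theorem consistentWith_transcript (M : Matroid E) (hM : M.E = univ) (T : CleanAlg E) :
    ConsistentWith M (T.transcript M) := by
  refine ⟨hM, ?_⟩
  induction T with
  | halt => simp [CleanAlg.transcript]
  | query S T₁ T₂ h₁ h₂ =>
    unfold CleanAlg.transcript
    split_ifs with h
    · simpa [h] using h₁
    · simpa [h] using h₂

theorem IsBasisCertificate.verifies [Finite E] {B : Finset E} (hB : B.Nonempty)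
    {L : List (Set E × Bool)} (hL : IsBasisCertificate L) (hc : ConsistentWith (soleBase B) L) :
    Verifies B L := by
  classical
  obtain ⟨C, hC⟩ := hL
  obtain rfl : C = B := (soleBase_isBase B C).1 (hC _ hc)
  constructor
  -- Without the query B itself, B may be a circuit: `properSubsets` differs from `soleBase B` only
  -- on B.
  · by_contra hno
    have hcon : ConsistentWith (properSubsets B hB) L := by
      refine ⟨rfl, ?_⟩
      rintro ⟨Q, b⟩ hp
      have h := hc.2 _ hp
      rw [soleBase_indep] at h
      rw [properSubsets_indep, ← h, Set.ssubset_iff_subset_ne, and_iff_left_iff_imp]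
      rintro hQ rfl
      obtain rfl : b = true := h.1 hQ
      exact hno hp
    exact (((properSubsets_indep B hB _).1 (hC _ hcon).indep).ne rfl)
  · intro e he
    -- Without such a rejected query, e could belong to the unique basis as well.
    by_contra! hno
    have hcon : ConsistentWith (soleBase (insert e B)) L := by
      refine ⟨rfl, ?_⟩
      rintro ⟨Q, b⟩ hp
      have h := hc.2 _ hp
      rw [soleBase_indep] at h
      rw [soleBase_indep, ← h, Finset.coe_insert]
      refine ⟨fun hQ => ?_, fun hQ => hQ.trans (subset_insert _ _)⟩
      cases b
      · exact absurd hQ (hno Q hp)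
      · exact h.2 rfl
    have h := (soleBase_isBase _ _).1 (hC _ hcon)
    exact he (Finset.coe_injective h ▸ Finset.mem_insert_self e B)

end Certificates

/-! ### Decision-tree bound for an antichain of bases -/

section Counting

variable {E : Type}

/-- If every candidate basis from an antichain has to be queried itself, then some candidate
requires `1 + log₂` of their number many queries. -/
theorem exists_two_mul_card_le_two_pow (T : CleanAlg E) (𝒜 : Finset (Finset E))
    (hne : 𝒜.Nonempty) (hanti : IsAntichain (· ⊆ ·) (𝒜 : Set (Finset E)))
    (hT : ∀ B ∈ 𝒜, ((B : Set E), true) ∈ T.transcript (soleBase B)) :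
    ∃ B ∈ 𝒜, 2 * 𝒜.card ≤ 2 ^ T.numQueries (soleBase B) := by
  classical
  induction T generalizing 𝒜 with
  | halt =>
    obtain ⟨B, hB⟩ := hne
    simpa [CleanAlg.transcript] using hT B hB
  | query S T₁ T₂ h₁ h₂ =>
    have hyes : ∀ B : Finset E, S ⊆ B → (CleanAlg.query S T₁ T₂).transcript (soleBase B) =
        (S, true) :: T₁.transcript (soleBase B) := by
      intro B h
      simp [CleanAlg.transcript, soleBase_indep, h]
    have hno : ∀ B : Finset E, ¬ S ⊆ B → (CleanAlg.query S T₁ T₂).transcript (soleBase B) =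
        (S, false) :: T₂.transcript (soleBase B) := by
      intro B h
      simp [CleanAlg.transcript, soleBase_indep, h]
    set Y := 𝒜.filter (fun B : Finset E => S ⊆ (B : Set E)) with hY
    set N := 𝒜.filter (fun B : Finset E => ¬ S ⊆ (B : Set E)) with hN
    have hcard : Y.card + N.card = 𝒜.card := by
      rw [hY, hN]
      exact Finset.card_filter_add_card_filter_not _
    have hNo : N.Nonempty → ∃ B ∈ 𝒜, 4 * N.card ≤
        2 ^ (CleanAlg.query S T₁ T₂).numQueries (soleBase B) := by
      intro hNne
      obtain ⟨B, hB, hle⟩ := h₂ N hNne (hanti.subset (Finset.coe_subset.2 (Finset.filter_subset _ _))) (by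
        intro B hB
        rw [hN, Finset.mem_filter] at hB
        have h := hT B hB.1
        rw [hno B hB.2] at h
        simpa using h)
      rw [hN, Finset.mem_filter] at hB
      refine ⟨B, hB.1, ?_⟩
      rw [CleanAlg.numQueries, hno B hB.2, List.length_cons, pow_succ]
      rw [CleanAlg.numQueries] at hle
      omega
    by_cases hS : ∃ A ∈ 𝒜, S = (A : Set E)
    · obtain ⟨A, hA, rfl⟩ := hS
      -- In an antichain, a query equal to a candidate splits off only that candidate.
      have hYA : Y = {A} := by
        ext B
        simp only [hY, Finset.mem_filter, Finset.mem_singleton, Finset.coe_subset]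
        refine ⟨fun h => (hanti.eq hA h.1 h.2).symm, ?_⟩
        rintro rfl
        exact ⟨hA, subset_rfl⟩
      rw [hYA, Finset.card_singleton] at hcard
      rcases N.eq_empty_or_nonempty with h0 | hne'
      · refine ⟨A, hA, ?_⟩
        rw [h0, Finset.card_empty] at hcard
        rw [CleanAlg.numQueries, hyes A subset_rfl, List.length_cons, pow_succ, ← hcard]
        have := Nat.one_le_two_pow (n := (T₁.transcript (soleBase A)).length)
        omega
      · obtain ⟨B, hB, hle⟩ := hNo hne'
        have := hne'.card_pos
        -- Here 4(|𝒜| - 1) ≥ 2|𝒜|, because N nonempty gives |𝒜| ≥ 2.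
        exact ⟨B, hB, by omega⟩
    · push Not at hS
      have hYes : Y.Nonempty → ∃ B ∈ 𝒜, 4 * Y.card ≤
          2 ^ (CleanAlg.query S T₁ T₂).numQueries (soleBase B) := by
        intro hYne
        obtain ⟨B, hB, hle⟩ := h₁ Y hYne (hanti.subset (Finset.coe_subset.2 (Finset.filter_subset _ _))) (by
          intro B hB
          rw [hY, Finset.mem_filter] at hB
          have h := hT B hB.1
          rw [hyes B hB.2] at h
          simpa [(hS B hB.1).symm] using h)
        rw [hY, Finset.mem_filter] at hB
        refine ⟨B, hB.1, ?_⟩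
        rw [CleanAlg.numQueries, hyes B hB.2, List.length_cons, pow_succ]
        rw [CleanAlg.numQueries] at hle
        omega
      have hpos := hne.card_pos
      -- The larger half has at least |𝒜|/2 members, and the query made supplies the lost factor 2.
      rcases le_total Y.card N.card with h | h
      · obtain ⟨B, hB, hle⟩ := hNo (Finset.card_pos.1 (by omega))
        exact ⟨B, hB, by omega⟩
      · obtain ⟨B, hB, hle⟩ := hYes (Finset.card_pos.1 (by omega))
        exact ⟨B, hB, by omega⟩

end Counting

/-! ### The adversary with isolated elements and pairs -/

section Adversary

variable {E : Type}

/-- What an adversary has committed itself to about the hidden basis: it contains `inside`, it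
contains no member of `pairs`, and all its other elements are in `isolated` or in a pair. -/
structure Position (E : Type) where
  inside : Finset E
  isolated : Finset E
  pairs : Finset (Finset E)

namespace Position

/-- The elements that the hidden basis may contain. -/
def Mem (P : Position E) (x : E) : Prop :=
  x ∈ P.inside ∨ x ∈ P.isolated ∨ ∃ w ∈ P.pairs, x ∈ w

structure Valid (P : Position E) : Prop where
  isolated_notMem : ∀ x ∈ P.isolated, x ∉ P.inside
  pair_card : ∀ w ∈ P.pairs, w.card = 2
  pair_notMem : ∀ w ∈ P.pairs, ∀ x ∈ w, x ∉ P.inside ∧ x ∉ P.isolated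
  pair_unique : ∀ w ∈ P.pairs, ∀ w' ∈ P.pairs, ∀ x ∈ w, x ∈ w' → w = w'

/-- The possible hidden bases of size `R`. -/
structure Admissible (P : Position E) (R : ℕ) (B : Finset E) : Prop where
  inside_subset : P.inside ⊆ B
  mem : ∀ x ∈ B, P.Mem x
  pair_not_subset : ∀ w ∈ P.pairs, ¬ w ⊆ B
  card_eq : B.card = R

/-- The query `S` is answered by `b` for every admissible hidden basis. -/
def Determines (P : Position E) (S : Set E) (b : Bool) : Prop :=
  (b = true ∧ S ⊆ P.inside) ∨
    (b = false ∧ ((∃ x ∈ S, ¬ P.Mem x) ∨ ∃ w ∈ P.pairs, (w : Set E) ⊆ S))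

/-- `P'` arises from `P` by further commitments. -/
structure Refines (P' P : Position E) : Prop where
  inside_subset : P.inside ⊆ P'.inside
  mem : ∀ x, P'.Mem x → P.Mem x
  pair : ∀ w ∈ P.pairs, w ∈ P'.pairs ∨ ∃ x ∈ w, ¬ P'.Mem x

/-- The counting invariant of the adversary after `q` queries, with `m` queries as its goal. -/
structure Budget (P : Position E) (m R q : ℕ) : Prop where
  inside_le : P.inside.card ≤ R
  le_card : R ≤ P.isolated.card + P.pairs.card + P.inside.card
  le_queries : m ≤ q + P.isolated.card + P.pairs.card
  -- With N the right-hand side of `le_card`, this says m ≤ q + |pairs| + 2(N - R). Pairing raises q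
  -- and |pairs| by one and lowers N by one, so it costs nothing here; at N = R the pairs alone
  -- cover the missing queries.
  reserve : m + 2 * R ≤ q + 2 * P.isolated.card + 3 * P.pairs.card + 2 * P.inside.card

theorem Refines.refl (P : Position E) : Refines P P :=
  ⟨subset_rfl, fun _ => id, fun _ h => Or.inl h⟩

theorem Refines.admissible {P' P : Position E} (h : Refines P' P) {R : ℕ} {B : Finset E}
    (hB : P'.Admissible R B) : P.Admissible R B where
  inside_subset := h.inside_subset.trans hB.inside_subset
  mem x hx := h.mem x (hB.mem x hx)
  pair_not_subset w hw hwB := by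
    rcases h.pair w hw with h' | ⟨x, hx, hx'⟩
    · exact hB.pair_not_subset w h' hwB
    · exact hx' (hB.mem x (hwB hx))
  card_eq := hB.card_eq

theorem Refines.determines {P' P : Position E} (h : Refines P' P) {S : Set E} {b : Bool}
    (hS : P.Determines S b) : P'.Determines S b := by
  rcases hS with ⟨hb, hS⟩ | ⟨hb, ⟨x, hx, hx'⟩ | ⟨w, hw, hwS⟩⟩
  · exact Or.inl ⟨hb, hS.trans (by simpa using h.inside_subset)⟩
  · exact Or.inr ⟨hb, Or.inl ⟨x, hx, fun h' => hx' (h.mem x h')⟩⟩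
  · rcases h.pair w hw with h' | ⟨x, hx, hx'⟩
    · exact Or.inr ⟨hb, Or.inr ⟨w, h', hwS⟩⟩
    · exact Or.inr ⟨hb, Or.inl ⟨x, hwS hx, hx'⟩⟩

theorem Determines.subset_iff {P : Position E} {S : Set E} {b : Bool} (hS : P.Determines S b)
    {R : ℕ} {B : Finset E} (hB : P.Admissible R B) : S ⊆ B ↔ b = true := by
  rcases hS with ⟨rfl, hS⟩ | ⟨rfl, ⟨x, hx, hx'⟩ | ⟨w, hw, hwS⟩⟩
  · simpa using hS.trans (by simpa using hB.inside_subset)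
  · simpa using fun h => hx' (hB.mem x (h hx))
  · simpa using fun h => hB.pair_not_subset w hw (by simpa using hwS.trans h)

theorem Budget.succ {P : Position E} {m R q : ℕ} (h : P.Budget m R q) : P.Budget m R (q + 1) := by
  obtain ⟨h1, h2, h3, h4⟩ := h
  constructor <;> omega

/-- One representative per pair, together with all isolated and inside elements, contains no pair
and has at least R elements by `le_card`; B is cut down from this set. -/
theorem Valid.exists_admissible {P : Position E} (hP : P.Valid) {m R q : ℕ}
    (hb : P.Budget m R q) : ∃ B, P.Admissible R B := by
  classical
  have hne : ∀ w : P.pairs, ∃ x, x ∈ w.1 := fun w =>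
    Finset.card_pos.1 (by rw [hP.pair_card w.1 w.2]; norm_num)
  choose r hr using hne
  have hinj : Function.Injective r := fun w w' h =>
    Subtype.ext (hP.pair_unique w.1 w.2 w'.1 w'.2 (r w) (hr w) (h ▸ hr w'))
  have hd1 : Disjoint P.isolated (P.pairs.attach.image r) := by
    rw [Finset.disjoint_right]
    intro x hx
    obtain ⟨w, -, rfl⟩ := Finset.mem_image.1 hx
    exact (hP.pair_notMem w.1 w.2 _ (hr w)).2
  have hd2 : Disjoint P.inside (P.isolated ∪ P.pairs.attach.image r) := by
    rw [Finset.disjoint_right]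
    intro x hx
    rcases Finset.mem_union.1 hx with hx | hx
    · exact hP.isolated_notMem x hx
    · obtain ⟨w, -, rfl⟩ := Finset.mem_image.1 hx
      exact (hP.pair_notMem w.1 w.2 _ (hr w)).1
  obtain ⟨B, hB1, hB2, hB3⟩ := Finset.exists_subsuperset_card_eq
    (Finset.subset_union_left (s₁ := P.inside) (s₂ := P.isolated ∪ P.pairs.attach.image r))
    hb.inside_le (by
      rw [Finset.card_union_of_disjoint hd2, Finset.card_union_of_disjoint hd1,
        Finset.card_image_of_injective _ hinj, Finset.card_attach]
      have := hb.le_card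
      omega)
  have hcases : ∀ x ∈ B, x ∈ P.inside ∨ x ∈ P.isolated ∨ ∃ w : P.pairs, r w = x := by
    intro x hx
    simpa using hB2 hx
  refine ⟨B, hB1, fun x hx => ?_, fun w hw hwB => ?_, hB3⟩
  · rcases hcases x hx with h | h | ⟨w, rfl⟩
    · exact Or.inl h
    · exact Or.inr (Or.inl h)
    · exact Or.inr (Or.inr ⟨w.1, w.2, hr w⟩)
  · have honly : ∀ x ∈ w, x = r ⟨w, hw⟩ := by
      intro x hx
      have hnot := hP.pair_notMem w hw x hx
      rcases hcases x (hwB hx) with h | h | ⟨w', rfl⟩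
      · exact absurd h hnot.1
      · exact absurd h hnot.2
      · congr 1
        exact Subtype.ext (hP.pair_unique w'.1 w'.2 w hw _ (hr w') hx)
    have := Finset.card_le_one.2 fun a ha b hb => (honly a ha).trans (honly b hb).symm
    have := hP.pair_card w hw
    omega

/-- The recorded answers verify an admissible basis only once the goal of `m` queries is met. -/
theorem Valid.le_of_verifies {P : Position E} (hP : P.Valid) {m R : ℕ}
    {L : List (Set E × Bool)} (hb : P.Budget m R L.length) (hL : ∀ p ∈ L, P.Determines p.1 p.2)
    {B : Finset E} (hB : P.Admissible R B) (hv : Verifies B L) : m ≤ L.length := by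
  have hBin : B = P.inside := by
    rcases hL _ hv.1 with ⟨-, h⟩ | ⟨h, -⟩
    · exact Finset.Subset.antisymm (by simpa using h) hB.inside_subset
    · simp at h
  have hmem : ∀ e, P.Mem e → e ∈ P.inside := by
    intro e he
    by_contra hin
    obtain ⟨Q, hQ, hsub⟩ := hv.2 e (hBin ▸ hin)
    rcases hL _ hQ with ⟨h, -⟩ | ⟨-, ⟨x, hx, hx'⟩ | ⟨w, hw, hwQ⟩⟩
    · simp at h
    · rcases hsub hx with rfl | h
      · exact hx' he
      · exact hx' (hB.mem x h)
    -- A pair avoids B = `inside`, so within `insert e B` it would shrink to the one element e.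
    · have honly : ∀ x ∈ w, x = e := fun x hx =>
        (hsub (hwQ hx)).resolve_right fun h => (hP.pair_notMem w hw x hx).1 (hBin ▸ h)
      have := Finset.card_le_one.2 fun a ha b hb => (honly a ha).trans (honly b hb).symm
      have := hP.pair_card w hw
      omega
  have h1 : P.isolated = ∅ := Finset.eq_empty_of_forall_notMem fun x hx =>
    hP.isolated_notMem x hx (hmem x (Or.inr (Or.inl hx)))
  have h2 : P.pairs = ∅ := Finset.eq_empty_of_forall_notMem fun w hw => by
    obtain ⟨x, hx⟩ := Finset.card_pos.1 (show 0 < w.card by rw [hP.pair_card w hw]; norm_num)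
    exact (hP.pair_notMem w hw x hx).1 (hmem x (Or.inr (Or.inr ⟨w, hw, hx⟩)))
  simpa [h1, h2] using hb.le_queries

section Moves

variable [DecidableEq E] {P : Position E} {m R q : ℕ} {S : Set E}

/-- Excluding an element of a pair isolates its partner. -/
theorem Valid.exclude_paired (hP : P.Valid) (hb : P.Budget m R q) {w : Finset E}
    (hw : w ∈ P.pairs) {x : E} (hx : x ∈ w) (hxS : x ∈ S) :
    ∃ P' : Position E, P'.Valid ∧ P'.Budget m R (q + 1) ∧ Refines P' P ∧
      P'.Determines S false := by
  obtain ⟨y, hy⟩ := Finset.card_eq_one.1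
    (show (w.erase x).card = 1 by rw [Finset.card_erase_of_mem hx, hP.pair_card w hw])
  have hyw : y ∈ w ∧ y ≠ x := by
    have := Finset.mem_singleton_self y
    rw [← hy, Finset.mem_erase] at this
    exact ⟨this.2, this.1⟩
  have hxn := hP.pair_notMem w hw x hx
  have hyn := hP.pair_notMem w hw y hyw.1
  let P' : Position E := ⟨P.inside, insert y P.isolated, P.pairs.erase w⟩
  have hxP' : ¬ P'.Mem x := by
    rintro (h | h | ⟨w', hw', hx'⟩)
    · exact hxn.1 h
    · rcases Finset.mem_insert.1 h with h | h
      · exact hyw.2 h.symm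
      · exact hxn.2 h
    · have h := Finset.mem_erase.1 hw'
      exact h.1 (hP.pair_unique w' h.2 w hw x hx' hx)
  refine ⟨P', ?_, ?_, ⟨subset_rfl, ?_, ?_⟩, Or.inr ⟨rfl, Or.inl ⟨x, hxS, hxP'⟩⟩⟩
  · constructor
    · intro z hz
      rcases Finset.mem_insert.1 hz with rfl | hz
      · exact hyn.1
      · exact hP.isolated_notMem z hz
    · exact fun w' hw' => hP.pair_card w' (Finset.mem_of_mem_erase hw')
    · intro w' hw'' z hz
      obtain ⟨hne, hw'⟩ : w' ≠ w ∧ w' ∈ P.pairs := Finset.mem_erase.1 hw''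
      have hzn := hP.pair_notMem w' hw' z hz
      refine ⟨hzn.1, fun h => ?_⟩
      rcases Finset.mem_insert.1 h with rfl | h
      · exact hne (hP.pair_unique w' hw' w hw z hz hyw.1)
      · exact hzn.2 h
    · exact fun w₁ h₁ w₂ h₂ => hP.pair_unique w₁ (Finset.mem_of_mem_erase h₁) w₂
        (Finset.mem_of_mem_erase h₂)
  · obtain ⟨b1, b2, b3, b4⟩ := hb
    have c1 : P'.isolated.card = P.isolated.card + 1 := Finset.card_insert_of_notMem hyn.2
    have c2 : P'.pairs.card + 1 = P.pairs.card := Finset.card_erase_add_one hw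
    have c3 : P'.inside = P.inside := rfl
    constructor <;> (try rw [c3]) <;> omega
  · rintro z (h | h | ⟨w', hw', hz⟩)
    · exact Or.inl h
    · rcases Finset.mem_insert.1 h with rfl | h
      · exact Or.inr (Or.inr ⟨w, hw, hyw.1⟩)
      · exact Or.inr (Or.inl h)
    · exact Or.inr (Or.inr ⟨w', Finset.mem_of_mem_erase hw', hz⟩)
  · intro w' hw'
    by_cases h : w' = w
    · exact Or.inr ⟨x, h ▸ hx, hxP'⟩
    · exact Or.inl (Finset.mem_erase.2 ⟨h, hw'⟩)

/-- Two isolated elements form a new pair. -/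
theorem Valid.pair_up (hP : P.Valid) (hb : P.Budget m R q) {x y : E} (hxy : x ≠ y)
    (hx : x ∈ P.isolated) (hy : y ∈ P.isolated) (hxS : x ∈ S) (hyS : y ∈ S)
    (hR : R < P.isolated.card + P.pairs.card + P.inside.card) :
    ∃ P' : Position E, P'.Valid ∧ P'.Budget m R (q + 1) ∧ Refines P' P ∧
      P'.Determines S false := by
  let P' : Position E := ⟨P.inside, (P.isolated.erase x).erase y, insert {x, y} P.pairs⟩
  have hiso : ∀ z ∈ ({x, y} : Finset E), z ∈ P.isolated := by
    intro z hz
    rcases Finset.mem_insert.1 hz with rfl | hz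
    · exact hx
    · rwa [Finset.mem_singleton.1 hz]
  have hnew : {x, y} ∉ P.pairs := fun h =>
    (hP.pair_notMem _ h x (Finset.mem_insert_self _ _)).2 hx
  refine ⟨P', ?_, ?_, ⟨subset_rfl, ?_, fun w hw => Or.inl (Finset.mem_insert_of_mem hw)⟩,
    Or.inr ⟨rfl, Or.inr ⟨{x, y}, Finset.mem_insert_self _ _, ?_⟩⟩⟩
  · constructor
    · exact fun z hz => hP.isolated_notMem z (Finset.mem_of_mem_erase (Finset.mem_of_mem_erase hz))
    · intro w hw
      rcases Finset.mem_insert.1 hw with rfl | hw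
      · exact Finset.card_pair hxy
      · exact hP.pair_card w hw
    · intro w hw z hz
      rcases Finset.mem_insert.1 hw with rfl | hw
      · refine ⟨hP.isolated_notMem z (hiso z hz), fun h => ?_⟩
        simp only [P', Finset.mem_erase] at h
        simp only [Finset.mem_insert, Finset.mem_singleton] at hz
        tauto
      · have hzn := hP.pair_notMem w hw z hz
        exact ⟨hzn.1, fun h => hzn.2 (Finset.mem_of_mem_erase (Finset.mem_of_mem_erase h))⟩
    · intro w₁ h₁ w₂ h₂ z hz₁ hz₂
      rcases Finset.mem_insert.1 h₁ with rfl | h₁ <;> rcases Finset.mem_insert.1 h₂ with rfl | h₂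
      · rfl
      · exact absurd (hiso z hz₁) (hP.pair_notMem w₂ h₂ z hz₂).2
      · exact absurd (hiso z hz₂) (hP.pair_notMem w₁ h₁ z hz₁).2
      · exact hP.pair_unique w₁ h₁ w₂ h₂ z hz₁ hz₂
  · obtain ⟨b1, b2, b3, b4⟩ := hb
    have c1 : P'.isolated.card + 1 = (P.isolated.erase x).card :=
      Finset.card_erase_add_one (Finset.mem_erase.2 ⟨hxy.symm, hy⟩)
    have c1' : (P.isolated.erase x).card + 1 = P.isolated.card := Finset.card_erase_add_one hx
    have c2 : P'.pairs.card = P.pairs.card + 1 := Finset.card_insert_of_notMem hnew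
    have c3 : P'.inside = P.inside := rfl
    constructor <;> (try rw [c3]) <;> omega
  · rintro z (h | h | ⟨w, hw, hz⟩)
    · exact Or.inl h
    · exact Or.inr (Or.inl (Finset.mem_of_mem_erase (Finset.mem_of_mem_erase h)))
    · rcases Finset.mem_insert.1 hw with rfl | hw
      · exact Or.inr (Or.inl (hiso z hz))
      · exact Or.inr (Or.inr ⟨w, hw, hz⟩)
  · intro z hz
    rcases Finset.mem_insert.1 hz with rfl | hz
    · exact hxS
    · rwa [Finset.mem_singleton.1 hz]

/-- A set of isolated elements is accepted. -/
theorem Valid.accept (hP : P.Valid) (hb : P.Budget m R q) {A : Finset E} (hA : A ⊆ P.isolated)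
    (hS : ∀ x ∈ S, x ∈ P.inside ∨ x ∈ A)
    (hcard : (A.card = 1 ∧ P.inside.card < R) ∨
      P.isolated.card + P.pairs.card + P.inside.card = R) :
    ∃ P' : Position E, P'.Valid ∧ P'.Budget m R (q + 1) ∧ Refines P' P ∧
      P'.Determines S true := by
  let P' : Position E := ⟨P.inside ∪ A, P.isolated \ A, P.pairs⟩
  refine ⟨P', ?_, ?_, ⟨Finset.subset_union_left, ?_, fun w hw => Or.inl hw⟩,
    Or.inl ⟨rfl, fun x hx => by simpa [P'] using hS x hx⟩⟩
  · constructor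
    · intro z hz h
      obtain ⟨hz, hzA⟩ := Finset.mem_sdiff.1 hz
      rcases Finset.mem_union.1 h with h | h
      · exact hP.isolated_notMem z hz h
      · exact hzA h
    · exact hP.pair_card
    · intro w hw z hz
      have hzn := hP.pair_notMem w hw z hz
      refine ⟨fun h => ?_, fun h => hzn.2 (Finset.mem_sdiff.1 h).1⟩
      rcases Finset.mem_union.1 h with h | h
      · exact hzn.1 h
      · exact hzn.2 (hA h)
    · exact hP.pair_unique
  · obtain ⟨b1, b2, b3, b4⟩ := hb
    have c1 : P'.isolated.card + A.card = P.isolated.card :=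
      Finset.card_sdiff_add_card_eq_card hA
    have c2 : P'.inside.card = P.inside.card + A.card :=
      Finset.card_union_of_disjoint (Finset.disjoint_right.2 fun z hz =>
        hP.isolated_notMem z (hA hz))
    have c3 : P'.pairs = P.pairs := rfl
    -- Accepting many elements at once breaks the step-by-step count; `le_queries` then comes from
    -- `reserve` at N = R.
    constructor <;> (try rw [c3]) <;> omega
  · rintro z (h | h | h)
    · rcases Finset.mem_union.1 h with h | h
      · exact Or.inl h
      · exact Or.inr (Or.inl (hA h))
    · exact Or.inr (Or.inl (Finset.mem_sdiff.1 h).1)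
    · exact Or.inr (Or.inr h)

/-- An isolated element is excluded once the hidden basis is complete. -/
theorem Valid.exclude_isolated (hP : P.Valid) (hb : P.Budget m R q) {x : E}
    (hx : x ∈ P.isolated) (hxS : x ∈ S) (hR : R ≤ P.inside.card) :
    ∃ P' : Position E, P'.Valid ∧ P'.Budget m R (q + 1) ∧ Refines P' P ∧
      P'.Determines S false := by
  let P' : Position E := ⟨P.inside, P.isolated.erase x, P.pairs⟩
  have hxP' : ¬ P'.Mem x := by
    rintro (h | h | ⟨w, hw, h⟩)
    · exact hP.isolated_notMem x hx h
    · exact Finset.notMem_erase x _ h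
    · exact (hP.pair_notMem w hw x h).2 hx
  refine ⟨P', ?_, ?_, ⟨subset_rfl, ?_, fun w hw => Or.inl hw⟩,
    Or.inr ⟨rfl, Or.inl ⟨x, hxS, hxP'⟩⟩⟩
  · exact ⟨fun z hz => hP.isolated_notMem z (Finset.mem_of_mem_erase hz), hP.pair_card,
      fun w hw z hz => ⟨(hP.pair_notMem w hw z hz).1, fun h =>
        (hP.pair_notMem w hw z hz).2 (Finset.mem_of_mem_erase h)⟩, hP.pair_unique⟩
  · obtain ⟨b1, b2, b3, b4⟩ := hb
    have c1 : P'.isolated.card + 1 = P.isolated.card := Finset.card_erase_add_one hx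
    have c2 : P'.inside = P.inside := rfl
    have c3 : P'.pairs = P.pairs := rfl
    -- Since `inside` already has R elements, `reserve` follows from `le_queries`.
    constructor <;> (try rw [c2]) <;> (try rw [c3]) <;> omega
  · rintro z (h | h | h)
    · exact Or.inl h
    · exact Or.inr (Or.inl (Finset.mem_of_mem_erase h))
    · exact Or.inr (Or.inr h)

end Moves

/-- The adversary can answer every query within its budget. -/
theorem Valid.exists_move {P : Position E} (hP : P.Valid) {m R q : ℕ} (hb : P.Budget m R q)
    (S : Set E) : ∃ (b : Bool) (P' : Position E), P'.Valid ∧ P'.Budget m R (q + 1) ∧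
      Refines P' P ∧ P'.Determines S b := by
  classical
  by_cases hno : P.Determines S false
  · exact ⟨false, P, hP, hb.succ, Refines.refl P, hno⟩
  by_cases hyes : S ⊆ P.inside
  · exact ⟨true, P, hP, hb.succ, Refines.refl P, Or.inl ⟨rfl, hyes⟩⟩
  have hmem : ∀ x ∈ S, P.Mem x := fun x hx => by
    by_contra h
    exact hno (Or.inr ⟨rfl, Or.inl ⟨x, hx, h⟩⟩)
  by_cases hpair : ∃ w ∈ P.pairs, ∃ x ∈ w, x ∈ S
  · obtain ⟨w, hw, x, hx, hxS⟩ := hpair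
    exact ⟨false, hP.exclude_paired hb hw hx hxS⟩
  push Not at hpair
  have hcases : ∀ x ∈ S, x ∈ P.inside ∨ x ∈ P.isolated := by
    intro x hx
    rcases hmem x hx with h | h | ⟨w, hw, h⟩
    · exact Or.inl h
    · exact Or.inr h
    · exact absurd hx (hpair w hw x h)
  obtain ⟨x, hxS, hxin⟩ := Set.not_subset.1 hyes
  have hx : x ∈ P.isolated := (hcases x hxS).resolve_left hxin
  set A := P.isolated.filter (· ∈ S) with hA
  have hAS : ∀ z ∈ S, z ∈ P.inside ∨ z ∈ A := fun z hz =>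
    (hcases z hz).imp_right fun h => Finset.mem_filter.2 ⟨h, hz⟩
  -- Pairing is affordable only while more than R elements could still enter the basis.
  rcases hb.le_card.lt_or_eq with hR | hR
  · by_cases hy : ∃ y ∈ A, y ≠ x
    · obtain ⟨y, hy, hyx⟩ := hy
      obtain ⟨hy, hyS⟩ := Finset.mem_filter.1 hy
      exact ⟨false, hP.pair_up hb hyx hy hx hyS hxS hR⟩
    · push Not at hy
      by_cases hin : P.inside.card < R
      · refine ⟨true, hP.accept hb (Finset.filter_subset _ _) hAS (Or.inl ⟨?_, hin⟩)⟩
        exact Finset.card_eq_one.2 ⟨x, Finset.eq_singleton_iff_unique_mem.2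
          ⟨Finset.mem_filter.2 ⟨hx, hxS⟩, hy⟩⟩
      · exact ⟨false, hP.exclude_isolated hb hx hxS (not_lt.1 hin)⟩
  · exact ⟨true, hP.accept hb (Finset.filter_subset _ _) hAS (Or.inr hR.symm)⟩

/-- Whatever the algorithm asks, the adversary has a hidden basis costing `m` queries. -/
theorem Valid.exists_admissible_numQueries {m R : ℕ} (T : CleanAlg E) {P : Position E}
    (hP : P.Valid) {L : List (Set E × Bool)} (hb : P.Budget m R L.length)
    (hL : ∀ p ∈ L, P.Determines p.1 p.2)
    (hT : ∀ B, P.Admissible R B → Verifies B (L ++ T.transcript (soleBase B))) :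
    ∃ B, P.Admissible R B ∧ m ≤ L.length + T.numQueries (soleBase B) := by
  induction T generalizing P L with
  | halt =>
    obtain ⟨B, hB⟩ := hP.exists_admissible hb
    refine ⟨B, hB, (hP.le_of_verifies hb hL hB ?_).trans (Nat.le_add_right _ _)⟩
    simpa [CleanAlg.transcript] using hT B hB
  | query S T₁ T₂ h₁ h₂ =>
    obtain ⟨b, P', hP', hb', href, hdet⟩ := hP.exists_move hb S
    have hL' : ∀ p ∈ L ++ [(S, b)], P'.Determines p.1 p.2 := by
      intro p hp
      rcases List.mem_append.1 hp with hp | hp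
      · exact href.determines (hL p hp)
      · rw [List.mem_singleton.1 hp]
        exact hdet
    have hlen : (L ++ [(S, b)]).length = L.length + 1 := by simp
    rw [← hlen] at hb'
    have htr : ∀ B, P'.Admissible R B → (CleanAlg.query S T₁ T₂).transcript (soleBase B) =
        (S, b) :: (if b then T₁ else T₂).transcript (soleBase B) := by
      intro B hB
      have h := hdet.subset_iff hB
      cases b <;> simp_all [CleanAlg.transcript, soleBase_indep]
    have hT' : ∀ B, P'.Admissible R B →
        Verifies B (L ++ [(S, b)] ++ (if b then T₁ else T₂).transcript (soleBase B)) := by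
      intro B hB
      have h := hT B (href.admissible hB)
      rw [htr B hB] at h
      simpa using h
    have key : ∃ B, P'.Admissible R B ∧
        m ≤ (L ++ [(S, b)]).length + (if b then T₁ else T₂).numQueries (soleBase B) := by
      cases b
      · exact h₂ hP' hb' hL' hT'
      · exact h₁ hP' hb' hL' hT'
    obtain ⟨B, hB, hle⟩ := key
    refine ⟨B, href.admissible hB, ?_⟩
    rw [CleanAlg.numQueries, htr B hB, List.length_cons]
    rw [hlen, CleanAlg.numQueries] at hle
    omega

end Position

end Adversary

/-! ### The two lower bounds -/

theorem lemmaA2 (n rd ηA : ℕ) (hηA : 1 ≤ ηA) (hle : rd + ηA ≤ n) :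
    ∃ Md : Matroid (Fin n), Md.E = univ ∧ Md.eRank = (rd : ℕ∞) ∧
      ∀ T : CleanAlg (Fin n), T.SolvesKnowing Md ηA 0 →
        ((ηA : ℝ) ≤ ((n : ℝ) - rd) / 2 →
          ∃ (M : Matroid (Fin n)) (r : ℕ), IsCleanInstance Md M ηA 0 ∧ M.eRank = (r : ℕ∞) ∧
            (n : ℤ) - r + ηA ≤ T.numQueries M) ∧
        (((n : ℝ) - rd) / 2 ≤ (ηA : ℝ) →
          ∃ M : Matroid (Fin n), IsCleanInstance Md M ηA 0 ∧
            1 + ⌈Real.logb 2 ((n - rd).choose ηA : ℝ)⌉ ≤ (T.numQueries M : ℤ)) := by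
  obtain ⟨D, -, hD⟩ := Finset.exists_subset_card_eq
    (show rd ≤ (Finset.univ : Finset (Fin n)).card by simpa using by omega)
  refine ⟨soleBase D, rfl, by rw [soleBase_eRank, hD], fun T hT => ?_⟩
  have hinst : ∀ B : Finset (Fin n), D ⊆ B → B.card = rd + ηA →
      IsCleanInstance (soleBase D) (soleBase B) ηA 0 := by
    intro B hDB hB
    have h := isCleanInstance_soleBase hDB
    rwa [hB, hD, Nat.add_sub_cancel_left] at h
  have hver : ∀ B : Finset (Fin n), D ⊆ B → B.card = rd + ηA →
      Verifies B (T.transcript (soleBase B)) := fun B hDB hB =>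
    (hT _ (hinst B hDB hB)).verifies (Finset.card_pos.1 (by omega))
      (consistentWith_transcript _ rfl T)
  have hcompl : Dᶜ.card = n - rd := by rw [Finset.card_compl, Fintype.card_fin, hD]
  constructor
  · intro hhalf
    have hhalf' : 2 * ηA + rd ≤ n := by
      have : (2 * ηA + rd : ℝ) ≤ n := by linarith
      exact_mod_cast this
    let P : Position (Fin n) := ⟨D, Dᶜ, ∅⟩
    have hP : P.Valid := ⟨by simp [P], by simp [P], by simp [P], by simp [P]⟩
    -- At the start all n - rd elements outside D are isolated, and `reserve` is exactly 2ηA ≤ n -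
    -- rd.
    have hb : P.Budget (n - rd) (rd + ηA) ([] : List (Set (Fin n) × Bool)).length := by
      constructor <;> simp only [P, hcompl, hD, List.length_nil, Finset.card_empty] <;> omega
    obtain ⟨B, hB, hq⟩ := hP.exists_admissible_numQueries T hb (by simp)
      fun B hB => hver B hB.inside_subset hB.card_eq
    refine ⟨soleBase B, rd + ηA, hinst B hB.inside_subset hB.card_eq, ?_, ?_⟩
    · rw [soleBase_eRank, hB.card_eq]
    · rw [List.length_nil] at hq
      push_cast
      omega
  · intro _
    set 𝒜 := (Finset.powersetCard ηA Dᶜ).image (D ∪ ·) with h𝒜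
    have hdisj : ∀ A ∈ Finset.powersetCard ηA Dᶜ, Disjoint D A := fun A hA =>
      Finset.disjoint_left.2 fun x hx hxA =>
        Finset.mem_compl.1 ((Finset.mem_powersetCard.1 hA).1 hxA) hx
    have hcard : 𝒜.card = (n - rd).choose ηA := by
      rw [h𝒜, Finset.card_image_of_injOn, Finset.card_powersetCard, hcompl]
      intro A hA A' hA' h
      rw [← Finset.union_sdiff_cancel_left (hdisj A hA),
        ← Finset.union_sdiff_cancel_left (hdisj A' hA')]
      exact congrArg (· \ D) h
    have hmem : ∀ B ∈ 𝒜, D ⊆ B ∧ B.card = rd + ηA := by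
      intro B hB
      obtain ⟨A, hA, rfl⟩ := Finset.mem_image.1 hB
      exact ⟨Finset.subset_union_left, by
        rw [Finset.card_union_of_disjoint (hdisj A hA), hD, (Finset.mem_powersetCard.1 hA).2]⟩
    have hpos : 0 < (n - rd).choose ηA := Nat.choose_pos (by omega)
    obtain ⟨B, hB, hpow⟩ := exists_two_mul_card_le_two_pow T 𝒜
      (Finset.card_pos.1 (hcard ▸ hpos))
      (fun B hB B' hB' hne hsub => hne (Finset.eq_of_subset_of_card_le hsub
        (by rw [(hmem B hB).2, (hmem B' hB').2])))
      (fun B hB => (hver B (hmem B hB).1 (hmem B hB).2).1)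
    refine ⟨soleBase B, hinst B (hmem B hB).1 (hmem B hB).2, ?_⟩
    -- The -1 is the factor 2 in `hpow`; being an integer, it survives the ceiling.
    have hlog : Real.logb 2 ((n - rd).choose ηA : ℝ) ≤ T.numQueries (soleBase B) - 1 := by
      rw [Real.logb_le_iff_le_rpow one_lt_two (by exact_mod_cast hpos),
        Real.rpow_sub two_pos, Real.rpow_natCast, Real.rpow_one, le_div_iff₀ two_pos, mul_comm,
        ← hcard]
      exact_mod_cast hpow
    have hceil : ⌈Real.logb 2 ((n - rd).choose ηA : ℝ)⌉ ≤ (T.numQueries (soleBase B) : ℤ) - 1 :=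
      Int.ceil_le.2 (by push_cast; exact hlog)
    omega
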